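/- Let $G$ be a finite group (with the discrete topology) or a compact Lie group. Let $\mathcal H$ and $\mathcal K$ be finite-dimensional complex Hilbert spaces (possibly equal) carrying continuous unitary representations $U$ and $V$ of $G$ respectively. A quantum operation from $\mathcal B(\mathcal H)$ to $\mathcal B(\mathcal K)$ is a completely positive trace-preserving linear map $\mathcal E$; it is $G$-covariant if $\mathcal E(U(g)XU(g)^\dagger)=V(g)\mathcal E(X)V(g)^\dagger$ for all $g\in G$ and all $X\in\mathcal B(\mathcal H)$, and $G$-covariance of operations from $\mathcal B(\mathcal K)$ to $\mathcal B(\mathcal H)$ is defined in the same way. Unit vectors $|\psi\rangle\in\mathcal H$ and $|\phi\rangle\in\mathcal K$ are called $G$-equivalent if there are a $G$-covariant quantum operation $\mathcal E$ from $\mathcal B(\mathcal H)$ to $\mathcal B(\mathcal K)$ with $\mathcal E(|\psi\rangle\langle\psi|)=|\phi\rangle\langle\phi|$ and a $G$-covariant quantum operation $\mathcal F$ from $\mathcal B(\mathcal K)$ to $\mathcal B(\mathcal H)$ with $\mathcal F(|\phi\rangle\langle\phi|)=|\psi\rangle\langle\psi|$. Suppose that the characteristic functions $\chi_\psi(g)=\langle\psi|U(g)|\psi\rangle$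 and $\chi_\phi(g)=\langle\phi|V(g)|\phi\rangle$ are nonzero for every $g\in G$. Then $|\psi\rangle$ and $|\phi\rangle$ are $G$-equivalent if and only if there is a one-dimensional unitary representation of $G$, that is, a continuous homomorphism $e^{i\Theta}$ from $G$ to the unit circle, such that $$\forall g\in G:\quad \langle\psi|U(g)|\psi\rangle = e^{i\Theta(g)}\,\langle\phi|V(g)|\phi\rangle .$$ -/

import Mathlib

open scoped ContDiff Manifold

/-- `G` is a finite group (with its discrete topology) or a compact real Lie group. -/
def IsFiniteOrCompactLieGroup (G : Type*) [Group G] [TopologicalSpace G] : Prop :=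
  (Finite G ∧ DiscreteTopology G) ∨
    (CompactSpace G ∧ T2Space G ∧
      ∃ (n : ℕ) (_ : ChartedSpace (EuclideanSpace ℝ (Fin n)) G), LieGroup (𝓡 n) ∞ G)

/-- A unitary representation of `G` on the (finite-dimensional) Hilbert space `H`: a continuous
homomorphism into the unitary group of `H`. For a discrete group continuity is automatic. -/
abbrev UnitaryRep (G H : Type*) [Group G] [TopologicalSpace G] [NormedAddCommGroup H]
    [InnerProductSpace ℂ H] [CompleteSpace H] : Type _ :=
  G →ₜ* unitary (H →L[ℂ] H)

/-- The characteristic function `χ_ψ(g) = ⟨ψ|U(g)|ψ⟩`; `inner` is linear in its second argument. -/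
noncomputable def charFn {G H : Type*} [Group G] [TopologicalSpace G] [NormedAddCommGroup H]
    [InnerProductSpace ℂ H] [CompleteSpace H] (U : UnitaryRep G H) (ψ : H) (g : G) : ℂ :=
  inner ℂ ψ ((U g : H →L[ℂ] H) ψ)

/-- The density operator `|ψ⟩⟨ψ|` of the pure state given by the unit vector `ψ`. -/
noncomputable def pureState {H : Type*} [NormedAddCommGroup H] [InnerProductSpace ℂ H] (ψ : H) :
    H →L[ℂ] H :=
  InnerProductSpace.rankOne ℂ ψ ψ

/-- The action `𝒰(g)[X] = U(g) X U(g)†` of the symmetry group on operators. -/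
noncomputable def UnitaryRep.conj {G H : Type*} [Group G] [TopologicalSpace G]
    [NormedAddCommGroup H] [InnerProductSpace ℂ H] [CompleteSpace H] (U : UnitaryRep G H) (g : G)
    (X : H →L[ℂ] H) : H →L[ℂ] H :=
  (U g : H →L[ℂ] H) * X * star (U g : H →L[ℂ] H)

/-- A quantum operation: a completely positive, trace-preserving linear map between the operator
algebras of two finite-dimensional Hilbert spaces. -/
structure QuantumOperation (H K : Type*) [NormedAddCommGroup H] [InnerProductSpace ℂ H]
    [CompleteSpace H] [FiniteDimensional ℂ H] [NormedAddCommGroup K] [InnerProductSpace ℂ K]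
    [CompleteSpace K] [FiniteDimensional ℂ K] extends
    CompletelyPositiveMap (H →L[ℂ] H) (K →L[ℂ] K) where
  trace_preserving (X : H →L[ℂ] H) :
    LinearMap.trace ℂ K (toLinearMap X : K →ₗ[ℂ] K) = LinearMap.trace ℂ H (X : H →ₗ[ℂ] H)

section Covariance

variable {G H K : Type*} [Group G] [TopologicalSpace G]
  [NormedAddCommGroup H] [InnerProductSpace ℂ H] [CompleteSpace H] [FiniteDimensional ℂ H]
  [NormedAddCommGroup K] [InnerProductSpace ℂ K] [CompleteSpace K] [FiniteDimensional ℂ K]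

/-- `E` is `G`-covariant with respect to the representations `U` on its input space and `V` on its
output space. -/
def QuantumOperation.IsCovariant (E : QuantumOperation H K) (U : UnitaryRep G H)
    (V : UnitaryRep G K) : Prop :=
  ∀ (g : G) (X : H →L[ℂ] H), E.toLinearMap (U.conj g X) = V.conj g (E.toLinearMap X)

/-- The state `ρ` can be transformed into the state `σ` by a `G`-covariant quantum operation. -/
def CovConvertible (U : UnitaryRep G H) (V : UnitaryRep G K) (ρ : H →L[ℂ] H) (σ : K →L[ℂ] K) :
    Prop :=
  ∃ E : QuantumOperation H K, E.IsCovariant U V ∧ E.toLinearMap ρ = σ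

/-- `G`-equivalence: `ρ` and `σ` are reversibly interconvertible by `G`-covariant operations. -/
def GEquivalent (U : UnitaryRep G H) (V : UnitaryRep G K) (ρ : H →L[ℂ] H) (σ : K →L[ℂ] K) :
    Prop :=
  CovConvertible U V ρ σ ∧ CovConvertible V U σ ρ

end Covariance

/-!
If a completely positive map takes the pure states of vectors `v i` to those of `w i`, then
positivity on the matrix `(|v i⟩⟨v j|)` forces it to send `|v i⟩⟨v j|` to `A i j |w i⟩⟨w j|` with
`A` positive semidefinite. Applied to orbits of `ψ` and `φ`, and combined with trace preservation,
this makes `χ_ψ / χ_φ` a function of positive type with value `1` at `1`, hence of modulus at most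
`1`. Under `G`-equivalence the modulus is exactly `1`, and a unimodular function of positive type is
a character.

Conversely, twisting `V` by the character leaves `V.conj` unchanged and reduces to `χ_ψ = χ_φ`. Then
the orbits of `ψ` and `φ` have the same Gram matrix, so `U g ψ ↦ V g φ` extends to an intertwining
partial isometry `W`, and the covariant operation `X ↦ W X W† + tr((1 - W† W) X) 1 / dim K` takes
`ψ` to `φ`.
-/

open InnerProductSpace ContinuousLinearMap

section PosSemidef

open Matrix
open scoped ComplexOrder

variable {𝕜 n : Type*} [RCLike 𝕜]

theorem mulVec_single_sub_single {R m n : Type*} [CommRing R] [Fintype n] [DecidableEq n]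
    (A : Matrix m n R) (i j : n) (c : R) :
    A *ᵥ (Pi.single j 1 - c • Pi.single i 1) = A.col j - c • A.col i := by
  rw [mulVec_sub, mulVec_smul, mulVec_single_one, mulVec_single_one]

/- The vector `e_j - A i j • e_i` is `e_j` minus its projection to `e_i` for the form `A`. -/
theorem star_dotProduct_mulVec_single_sub [Fintype n] [DecidableEq n] {A : Matrix n n 𝕜}
    (hA : A.IsHermitian) (hdiag : ∀ i, A i i = 1) (i j : n) :
    star (Pi.single j 1 - A i j • Pi.single i 1) ⬝ᵥ
      (A *ᵥ (Pi.single j 1 - A i j • Pi.single i 1)) = ((1 - ‖A i j‖ ^ 2 : ℝ) : 𝕜) := by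
  have hji : A j i = star (A i j) := (hA.apply j i).symm
  rw [mulVec_single_sub_single]
  simp [sub_dotProduct, hdiag, hji, Pi.star_single, RCLike.conj_mul]

theorem norm_apply_le_one_of_posSemidef {A : Matrix n n 𝕜} (hA : A.PosSemidef)
    (hdiag : ∀ i, A i i = 1) (i j : n) : ‖A i j‖ ≤ 1 := by
  let B := A.submatrix ![i, j] ![i, j]
  have hB : B.PosSemidef := hA.submatrix _
  have h := hB.dotProduct_mulVec_nonneg (Pi.single 1 1 - B 0 1 • Pi.single 0 1)
  rw [star_dotProduct_mulVec_single_sub hB.isHermitian (fun _ => hdiag _), RCLike.ofReal_nonneg,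
    sub_nonneg] at h
  exact (sq_le_one_iff₀ (norm_nonneg _)).1 h

theorem apply_eq_mul_of_posSemidef {A : Matrix n n 𝕜} (hA : A.PosSemidef)
    (hdiag : ∀ i, A i i = 1) {i j : n} (hij : ‖A i j‖ = 1) (k : n) : A k j = A k i * A i j := by
  let B := A.submatrix ![i, j, k] ![i, j, k]
  have hB : B.PosSemidef := hA.submatrix _
  have hB₀₁ : ‖B 0 1‖ = 1 := hij
  have hker : B *ᵥ (Pi.single 1 1 - B 0 1 • Pi.single 0 1) = 0 := by
    rw [← hB.dotProduct_mulVec_zero_iff,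
      star_dotProduct_mulVec_single_sub hB.isHermitian (fun _ => hdiag _), hB₀₁]
    simp
  rw [mulVec_single_sub_single] at hker
  have hkj : A k j - A i j * A k i = 0 := congrFun hker 2
  rw [sub_eq_zero.1 hkj, mul_comm]

end PosSemidef

section CompletelyPositive

/- Stated for an abstract algebra since instance resolution fails on `CStarMatrix` directly. -/
theorem exists_eq_star_mul_self_of_nonneg {A : Type*} [NonUnitalCStarAlgebra A] [PartialOrder A]
    [StarOrderedRing A] {a : A} (ha : 0 ≤ a) : ∃ b, a = star b * b :=
  CStarAlgebra.nonneg_iff_eq_star_mul_self.1 ha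

theorem cstarMatrix_sum_apply {ι m n A : Type*} [AddCommMonoid A] (s : Finset ι)
    (M : ι → CStarMatrix m n A) (i : m) (j : n) : (∑ r ∈ s, M r) i j = ∑ r ∈ s, M r i j :=
  Matrix.sum_apply i j s M

theorem cstarMatrix_star_mul_nonneg {n A : Type*} [Fintype n] [NonUnitalCStarAlgebra A]
    [PartialOrder A] [StarOrderedRing A] (a : n → A) :
    0 ≤ CStarMatrix.ofMatrix (Matrix.of fun i j => star (a i) * a j) := by
  classical
  rcases isEmpty_or_nonempty n with hn | ⟨⟨i₀⟩⟩
  · exact (CStarMatrix.ext fun i => hn.elim i).le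
  let R : CStarMatrix n n A :=
    CStarMatrix.ofMatrix (Matrix.of fun i j => if i = i₀ then a j else 0)
  have hR : CStarMatrix.ofMatrix (Matrix.of fun i j => star (a i) * a j) = star R * R := by
    ext1 i j
    simp [R, CStarMatrix.mul_apply, CStarMatrix.star_apply]
  exact hR ▸ star_mul_self_nonneg R

theorem exists_eq_rankOne_of_apply_eq_zero {𝕜 H K : Type*} [RCLike 𝕜] [NormedAddCommGroup H]
    [InnerProductSpace 𝕜 H] [NormedAddCommGroup K] [InnerProductSpace 𝕜 K] {T : H →L[𝕜] K} {w : H}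
    (h : ∀ x, inner 𝕜 w x = 0 → T x = 0) : ∃ u, T = rankOne 𝕜 u w := by
  rcases eq_or_ne w 0 with rfl | hw
  · exact ⟨0, by ext x; simpa using h x (inner_zero_left x)⟩
  have hww : inner 𝕜 w w ≠ 0 := inner_self_ne_zero.2 hw
  refine ⟨(inner 𝕜 w w)⁻¹ • T w, ?_⟩
  ext x
  have hx := h (x - (inner 𝕜 w x / inner 𝕜 w w) • w) (by
    rw [inner_sub_right, inner_smul_right, div_mul_cancel₀ _ hww, sub_self])
  rw [map_sub, map_smul, sub_eq_zero] at hx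
  rw [hx, rankOne_apply, smul_smul, div_eq_mul_inv]

theorem apply_eq_zero_of_inner_sum_adjoint_comp_self {𝕜 H K ι : Type*} [RCLike 𝕜]
    [NormedAddCommGroup H] [InnerProductSpace 𝕜 H] [CompleteSpace H] [NormedAddCommGroup K]
    [InnerProductSpace 𝕜 K] [CompleteSpace K] [Fintype ι] {B : ι → H →L[𝕜] K} {x : H}
    (h : inner 𝕜 x ((∑ r, adjoint (B r) ∘L B r) x) = 0) (r : ι) : B r x = 0 := by
  have hsum : ∑ r, ‖B r x‖ ^ 2 = 0 := by
    rw [_root_.sum_apply, inner_sum] at h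
    simp only [comp_apply, adjoint_inner_right, inner_self_eq_norm_sq_to_K] at h
    exact_mod_cast h
  simpa using (Finset.sum_eq_zero_iff_of_nonneg fun r _ => sq_nonneg ‖B r x‖).1 hsum r
    (Finset.mem_univ r)

variable {H K : Type*} [NormedAddCommGroup H] [InnerProductSpace ℂ H] [CompleteSpace H]
  [NormedAddCommGroup K] [InnerProductSpace ℂ K] [CompleteSpace K]

theorem cstarMatrix_rankOne_nonneg {n : Type*} [Fintype n] (v : n → H) :
    0 ≤ CStarMatrix.ofMatrix (Matrix.of fun i j => rankOne ℂ (v i) (v j)) := by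
  rcases subsingleton_or_nontrivial H with _ | _
  · exact (CStarMatrix.ext fun i j => Subsingleton.elim _ _).le
  obtain ⟨u, hu⟩ := exists_norm_eq H zero_le_one
  have huv (i j : n) :
      rankOne ℂ (v i) (v j) = star (rankOne ℂ u (v i)) * rankOne ℂ u (v j) := by
    rw [star_eq_adjoint, adjoint_rankOne, mul_def, rankOne_comp_rankOne,
      inner_self_eq_norm_sq_to_K, hu]
    simp
  simp only [huv]
  exact cstarMatrix_star_mul_nonneg _

open scoped ComplexOrder in
theorem exists_posSemidef_map_rankOne (E : CompletelyPositiveMap (H →L[ℂ] H) (K →L[ℂ] K))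
    {n : Type*} [Finite n] {v : n → H} {w : n → K}
    (h : ∀ i, E (pureState (v i)) = pureState (w i)) :
    ∃ A : Matrix n n ℂ, A.PosSemidef ∧
      ∀ i j, E (rankOne ℂ (v i) (v j)) = A i j • rankOne ℂ (w i) (w j) := by
  have := Fintype.ofFinite n
  obtain ⟨B, hB⟩ := exists_eq_star_mul_self_of_nonneg
    (E.map_cstarMatrix_nonneg _ (cstarMatrix_rankOne_nonneg v))
  have hE (i j : n) : E (rankOne ℂ (v i) (v j)) = ∑ r, adjoint (B r i) ∘L B r j :=
    congrArg (fun M : CStarMatrix n n (K →L[ℂ] K) => M i j) hB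
  have hker (r i : n) (x : K) (hx : inner ℂ (w i) x = 0) : B r i x = 0 := by
    refine apply_eq_zero_of_inner_sum_adjoint_comp_self (B := fun r => B r i) ?_ r
    rw [← hE, ← pureState, h, pureState, rankOne_apply, hx, zero_smul, inner_zero_right]
  choose b hb using fun r i => exists_eq_rankOne_of_apply_eq_zero (hker r i)
  refine ⟨∑ r, Matrix.gram ℂ (b r),
    Matrix.posSemidef_sum _ fun r _ => Matrix.posSemidef_gram ℂ (b r), fun i j => ?_⟩
  rw [hE, Matrix.sum_apply, Finset.sum_smul]
  refine Finset.sum_congr rfl fun r _ => ?_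
  rw [hb, hb, adjoint_rankOne, rankOne_comp_rankOne, Matrix.gram_apply]

end CompletelyPositive

section Kraus

variable {H K : Type*} [NormedAddCommGroup H] [InnerProductSpace ℂ H] [CompleteSpace H]
  [NormedAddCommGroup K] [InnerProductSpace ℂ K] [CompleteSpace K]

theorem cstarMatrix_adjoint_comp_nonneg [FiniteDimensional ℂ H] {n : Type*} [Fintype n]
    (T : n → K →L[ℂ] H) :
    0 ≤ CStarMatrix.ofMatrix (Matrix.of fun i j => adjoint (T i) ∘L T j) := by
  let e := stdOrthonormalBasis ℂ H
  have hsum (i j : n) : adjoint (T i) ∘L T j =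
      ∑ l, rankOne ℂ (adjoint (T i) (e l)) (adjoint (T j) (e l)) := by
    calc adjoint (T i) ∘L T j = adjoint (T i) ∘L (∑ l, rankOne ℂ (e l) (e l)) ∘L T j := by
          rw [e.sum_rankOne_eq_id, id_comp]
      _ = _ := by simp only [finsetSum_comp, comp_finsetSum, rankOne_comp, comp_rankOne]
  have hM : CStarMatrix.ofMatrix (Matrix.of fun i j => adjoint (T i) ∘L T j) =
      ∑ l, CStarMatrix.ofMatrix (Matrix.of fun i j =>
        rankOne ℂ (adjoint (T i) (e l)) (adjoint (T j) (e l))) := by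
    ext1 i j
    rw [cstarMatrix_sum_apply]
    exact hsum i j
  rw [hM]
  exact Finset.sum_nonneg fun l _ => cstarMatrix_rankOne_nonneg _

/-- The completely positive map `X ↦ ∑ i, L i X (L i)†` with Kraus operators `L i`, bundled as a
linear map so that it can be used before complete positivity is known. -/
noncomputable def krausMap {ι : Type*} [Fintype ι] (L : ι → H →L[ℂ] K) :
    (H →L[ℂ] H) →ₗ[ℂ] (K →L[ℂ] K) where
  toFun X := ∑ i, L i ∘L X ∘L adjoint (L i)
  map_add' X Y := by simp only [add_comp, comp_add, Finset.sum_add_distrib]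
  map_smul' c X := by simp only [smul_comp, comp_smul, Finset.smul_sum, RingHom.id_apply]

variable {ι : Type*} [Fintype ι]

theorem krausMap_apply (L : ι → H →L[ℂ] K) (X : H →L[ℂ] H) :
    krausMap L X = ∑ i, L i ∘L X ∘L adjoint (L i) := rfl

theorem cstarMatrix_map_krausMap_nonneg [FiniteDimensional ℂ H] (L : ι → H →L[ℂ] K) {n : Type*}
    [Fintype n] {M : CStarMatrix n n (H →L[ℂ] H)} (hM : 0 ≤ M) : 0 ≤ M.map (krausMap L) := by
  obtain ⟨B, rfl⟩ := exists_eq_star_mul_self_of_nonneg hM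
  have hsum : (star B * B).map (krausMap L) = ∑ k, ∑ r, CStarMatrix.ofMatrix (Matrix.of fun i j =>
      adjoint (B r i ∘L adjoint (L k)) ∘L (B r j ∘L adjoint (L k))) := by
    ext1 i j
    simp only [cstarMatrix_sum_apply, CStarMatrix.map_apply, CStarMatrix.mul_apply,
      CStarMatrix.star_apply, CStarMatrix.ofMatrix_apply, Matrix.of_apply, krausMap_apply,
      star_eq_adjoint, mul_def, adjoint_comp, adjoint_adjoint, finsetSum_comp, comp_finsetSum,
      comp_assoc]
  rw [hsum]
  exact Finset.sum_nonneg fun k _ => Finset.sum_nonneg fun r _ =>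
    cstarMatrix_adjoint_comp_nonneg _

variable [FiniteDimensional ℂ H] [FiniteDimensional ℂ K]

theorem trace_krausMap (L : ι → H →L[ℂ] K) (X : H →L[ℂ] H) :
    LinearMap.trace ℂ K (krausMap L X : K →ₗ[ℂ] K) =
      LinearMap.trace ℂ H ((∑ i, adjoint (L i) ∘L L i) ∘L X : H →L[ℂ] H) := by
  simp only [krausMap_apply, finsetSum_comp, toLinearMap_sum, map_sum]
  refine Finset.sum_congr rfl fun i _ => ?_
  rw [← comp_assoc, toLinearMap_comp, LinearMap.trace_comp_comm', ← toLinearMap_comp, comp_assoc]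

/-- The quantum operation with Kraus operators `L i`; the completeness relation `hL` makes it trace
preserving. -/
noncomputable def QuantumOperation.ofKraus (L : ι → H →L[ℂ] K)
    (hL : ∑ i, adjoint (L i) ∘L L i = 1) : QuantumOperation H K where
  toLinearMap := krausMap L
  map_cstarMatrix_nonneg' _ _ hM := cstarMatrix_map_krausMap_nonneg L hM
  trace_preserving X := by
    change LinearMap.trace ℂ K (krausMap L X : K →ₗ[ℂ] K) = _
    rw [trace_krausMap, hL, one_def, id_comp]

/- Writing `T = ∑ l, u_l u_l†`, the Kraus operators are `f_k u_l† / √(dim K)` for an orthonormal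
basis `f` of `K`. -/
theorem exists_krausMap_eq_trace_smul_one [Nontrivial K] {T : H →L[ℂ] H} (hT : T.IsPositive) :
    ∃ (m : ℕ) (L : Fin m × Fin (Module.finrank ℂ K) → H →L[ℂ] K),
      ∑ p, adjoint (L p) ∘L L p = T ∧ ∀ X, krausMap L X =
        ((Module.finrank ℂ K : ℂ)⁻¹ * LinearMap.trace ℂ H (T ∘L X : H →L[ℂ] H)) • 1 := by
  obtain ⟨m, u, rfl⟩ := isPositive_iff_eq_sum_rankOne.1 hT
  let f := stdOrthonormalBasis ℂ K
  let c : ℝ := (√(Module.finrank ℂ K))⁻¹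
  have hc : (c : ℂ) * c = (Module.finrank ℂ K : ℂ)⁻¹ := by
    rw [← Complex.ofReal_mul, ← mul_inv, Real.mul_self_sqrt (Nat.cast_nonneg _)]
    simp
  refine ⟨m, fun p => (c : ℂ) • rankOne ℂ (f p.2) (u p.1), ?_, fun X => ?_⟩
  · have hterm (l : Fin m) (k : Fin (Module.finrank ℂ K)) :
        adjoint ((c : ℂ) • rankOne ℂ (f k) (u l)) ∘L ((c : ℂ) • rankOne ℂ (f k) (u l)) =
          (Module.finrank ℂ K : ℂ)⁻¹ • rankOne ℂ (u l) (u l) := by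
      rw [map_smulₛₗ, Complex.conj_ofReal, adjoint_rankOne, smul_comp, comp_smul,
        rankOne_comp_rankOne, inner_self_eq_norm_sq_to_K, f.norm_eq_one, smul_smul, hc]
      simp
    have hd : (Module.finrank ℂ K : ℂ) ≠ 0 := Nat.cast_ne_zero.2 Module.finrank_pos.ne'
    simp only [Fintype.sum_prod_type, hterm, Finset.sum_const, Finset.card_univ, Fintype.card_fin,
      ← Nat.cast_smul_eq_nsmul ℂ, smul_inv_smul₀ hd]
  · have hterm (l : Fin m) (k : Fin (Module.finrank ℂ K)) :
        ((c : ℂ) • rankOne ℂ (f k) (u l)) ∘L X ∘L adjoint ((c : ℂ) • rankOne ℂ (f k) (u l)) =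
          ((Module.finrank ℂ K : ℂ)⁻¹ * inner ℂ (u l) (X (u l))) • rankOne ℂ (f k) (f k) := by
      rw [map_smulₛₗ, Complex.conj_ofReal, adjoint_rankOne, comp_smul, comp_rankOne, comp_smul,
        smul_comp, rankOne_comp_rankOne, smul_smul, smul_smul, hc]
    have htrace (l : Fin m) : LinearMap.trace ℂ H (rankOne ℂ (u l) (u l) ∘L X : H →L[ℂ] H) =
        inner ℂ (u l) (X (u l)) := by
      rw [rankOne_comp, trace_rankOne, adjoint_inner_left]
    simp only [krausMap_apply, Fintype.sum_prod_type, hterm, ← Finset.smul_sum,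
      f.sum_rankOne_eq_id, finsetSum_comp, toLinearMap_sum, map_sum, htrace, Finset.mul_sum,
      Finset.sum_smul, one_def]

theorem exists_quantumOperation_of_contraction [Nontrivial K] {W : H →L[ℂ] K}
    (hW : adjoint W ∘L W ≤ 1) :
    ∃ E : QuantumOperation H K, ∀ X, E.toLinearMap X = W ∘L X ∘L adjoint W +
      ((Module.finrank ℂ K : ℂ)⁻¹ *
        LinearMap.trace ℂ H ((1 - adjoint W ∘L W) ∘L X : H →L[ℂ] H)) • 1 := by
  obtain ⟨m, L, hL, hLX⟩ :=
    exists_krausMap_eq_trace_smul_one (K := K) ((ContinuousLinearMap.le_def _ _).1 hW)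
  let L' : Option (Fin m × Fin (Module.finrank ℂ K)) → H →L[ℂ] K := fun o => o.elim W L
  have hL' : ∑ o, adjoint (L' o) ∘L L' o = 1 := by
    simp only [Fintype.sum_option, L', Option.elim, hL, add_sub_cancel]
  refine ⟨.ofKraus L' hL', fun X => ?_⟩
  rw [← hLX]
  exact Fintype.sum_option _

end Kraus

section SpanIsometry

variable {𝕜 H K ι : Type*} [RCLike 𝕜] [NormedAddCommGroup H] [InnerProductSpace 𝕜 H]
  [NormedAddCommGroup K] [InnerProductSpace 𝕜 K]

theorem inner_linearCombination_eq {v : ι → H} {w : ι → K}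
    (h : ∀ i j, inner 𝕜 (v i) (v j) = inner 𝕜 (w i) (w j)) (a b : ι →₀ 𝕜) :
    inner 𝕜 (Finsupp.linearCombination 𝕜 v a) (Finsupp.linearCombination 𝕜 v b) =
      inner 𝕜 (Finsupp.linearCombination 𝕜 w a) (Finsupp.linearCombination 𝕜 w b) := by
  simp only [Finsupp.linearCombination_apply, Finsupp.sum, sum_inner, inner_sum, inner_smul_left,
    inner_smul_right, h]

theorem exists_linearIsometry_span_of_inner_eq {v : ι → H} {w : ι → K}
    (h : ∀ i j, inner 𝕜 (v i) (v j) = inner 𝕜 (w i) (w j)) :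
    ∃ T : Submodule.span 𝕜 (Set.range v) →ₗᵢ[𝕜] K,
      ∀ i, T ⟨v i, Submodule.subset_span (Set.mem_range_self i)⟩ = w i := by
  let A := Finsupp.linearCombination 𝕜 v
  let B := Finsupp.linearCombination 𝕜 w
  have hnorm (a : ι →₀ 𝕜) : ‖B a‖ ≤ 1 * ‖A a‖ := by
    rw [one_mul, @norm_eq_sqrt_re_inner 𝕜, @norm_eq_sqrt_re_inner 𝕜, inner_linearCombination_eq h]
  have hBA (a : ι →₀ 𝕜) : B.compLeftInverse A ⟨A a, a, rfl⟩ = B a :=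
    LinearMap.compLeftInverse_apply_of_bdd B A ⟨1, hnorm⟩ a _ rfl
  let T : LinearMap.range A →ₗᵢ[𝕜] K := (B.compLeftInverse A).toLinearMap.isometryOfInner <| by
    rintro ⟨_, a, rfl⟩ ⟨_, b, rfl⟩
    exact (congrArg₂ (inner 𝕜) (hBA a) (hBA b)).trans (inner_linearCombination_eq h a b).symm
  let e := LinearIsometryEquiv.ofEq _ _ (Finsupp.range_linearCombination 𝕜 (v := v)).symm
  refine ⟨T.comp e.toLinearIsometry, fun i => ?_⟩
  have hA : A (Finsupp.single i 1) = v i := by simp [A]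
  have hB : B (Finsupp.single i 1) = w i := by simp [B]
  rw [← hB, ← hBA]
  exact congrArg T (Subtype.ext hA.symm)

end SpanIsometry

section PartialIsometry

variable {𝕜 H K : Type*} [RCLike 𝕜] [NormedAddCommGroup H] [InnerProductSpace 𝕜 H]
  [CompleteSpace H] [NormedAddCommGroup K] [InnerProductSpace 𝕜 K] [CompleteSpace K]

theorem exists_partialIsometry_of_inner_eq {ι : Type*} {v : ι → H} {w : ι → K}
    (h : ∀ i j, inner 𝕜 (v i) (v j) = inner 𝕜 (w i) (w j))
    [(Submodule.span 𝕜 (Set.range v)).HasOrthogonalProjection] :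
    ∃ W : H →L[𝕜] K, (∀ i, W (v i) = w i) ∧
      adjoint W ∘L W = (Submodule.span 𝕜 (Set.range v)).starProjection ∧
      W ∘L (Submodule.span 𝕜 (Set.range v)).starProjection = W := by
  obtain ⟨T, hT⟩ := exists_linearIsometry_span_of_inner_eq h
  refine ⟨T.toContinuousLinearMap ∘L Submodule.orthogonalProjectionOnto _, fun i => ?_, ?_, ?_⟩
  · rw [← hT i]
    exact congrArg T (Submodule.orthogonalProjectionOnto_mem_subspace_eq_self ⟨v i, _⟩)
  · ext x
    refine ext_inner_left 𝕜 fun y => ?_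
    simpa [adjoint_inner_right] using Submodule.inner_starProjection_left_eq_right _ y x
  · ext x
    exact congrArg T (Submodule.orthogonalProjectionOnto_mem_subspace_eq_self _)

end PartialIsometry

section Representation

variable {G H : Type*} [Group G] [TopologicalSpace G] [NormedAddCommGroup H]
  [InnerProductSpace ℂ H] [CompleteSpace H]

namespace UnitaryRep

theorem map_mul_apply (U : UnitaryRep G H) (g h : G) (x : H) :
    (U (g * h) : H →L[ℂ] H) x = (U g : H →L[ℂ] H) ((U h : H →L[ℂ] H) x) := by
  rw [map_mul]; rfl

theorem map_one_apply (U : UnitaryRep G H) (x : H) : (U 1 : H →L[ℂ] H) x = x := by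
  rw [map_one]; rfl

theorem adjoint_eq_map_inv (U : UnitaryRep G H) (g : G) :
    adjoint (U g : H →L[ℂ] H) = (U g⁻¹ : H →L[ℂ] H) := by
  rw [map_inv]; rfl

theorem adjoint_comp_self (U : UnitaryRep G H) (g : G) :
    adjoint (U g : H →L[ℂ] H) ∘L (U g : H →L[ℂ] H) = 1 :=
  Unitary.star_mul_self_of_mem (U g).2

theorem comp_adjoint_self (U : UnitaryRep G H) (g : G) :
    (U g : H →L[ℂ] H) ∘L adjoint (U g : H →L[ℂ] H) = 1 :=
  Unitary.mul_star_self_of_mem (U g).2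

theorem conj_apply (U : UnitaryRep G H) (g : G) (X : H →L[ℂ] H) :
    U.conj g X = (U g : H →L[ℂ] H) ∘L X ∘L adjoint (U g : H →L[ℂ] H) :=
  mul_assoc _ _ _

theorem conj_pureState (U : UnitaryRep G H) (g : G) (ψ : H) :
    U.conj g (pureState ψ) = pureState ((U g : H →L[ℂ] H) ψ) := by
  rw [pureState, pureState, conj_apply, rankOne_comp, comp_rankOne, adjoint_adjoint]

theorem inner_map_apply_map_apply (U : UnitaryRep G H) (ψ : H) (g h : G) :
    inner ℂ ((U g : H →L[ℂ] H) ψ) ((U h : H →L[ℂ] H) ψ) = charFn U ψ (g⁻¹ * h) := by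
  rw [charFn, map_mul_apply, ← adjoint_eq_map_inv, adjoint_inner_right]

theorem charFn_one (U : UnitaryRep G H) (ψ : H) : charFn U ψ 1 = inner ℂ ψ ψ := by
  rw [charFn, map_one_apply]

theorem ne_zero_of_charFn_ne_zero (U : UnitaryRep G H) {ψ : H} {g : G} (h : charFn U ψ g ≠ 0) :
    ψ ≠ 0 := by
  rintro rfl
  exact h (inner_zero_left _)

theorem continuous_charFn (U : UnitaryRep G H) (ψ : H) : Continuous (charFn U ψ) := by
  have hU : Continuous fun g => (U g : H →L[ℂ] H) :=
    continuous_subtype_val.comp (map_continuous U)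
  exact continuous_const.inner (hU.clm_apply continuous_const)

/-- The tensor product of the one-dimensional representation `ξ` with `U`, realized on the space of
`U` itself; it absorbs the phase relating two characteristic functions. -/
noncomputable def twist (ξ : G →ₜ* Circle) (U : UnitaryRep G H) : UnitaryRep G H where
  toFun g := ⟨(ξ g : ℂ) • (U g : H →L[ℂ] H),
    Unitary.smul_mem_of_mem (by
      simp only [Unitary.mem_iff, RCLike.star_def, Complex.conj_mul', Complex.mul_conj',
        Circle.norm_coe, Complex.ofReal_one, one_pow, and_self]) (U g).2⟩
  map_one' := by ext; simp
  map_mul' g h := by ext; simp [smul_smul, mul_comm]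
  continuous_toFun :=
    ((continuous_subtype_val.comp (map_continuous ξ)).smul
      (continuous_subtype_val.comp (map_continuous U))).subtype_mk _

theorem coe_twist_apply (ξ : G →ₜ* Circle) (U : UnitaryRep G H) (g : G) :
    (U.twist ξ g : H →L[ℂ] H) = (ξ g : ℂ) • (U g : H →L[ℂ] H) := rfl

theorem charFn_twist (ξ : G →ₜ* Circle) (U : UnitaryRep G H) (ψ : H) (g : G) :
    charFn (U.twist ξ) ψ g = ξ g * charFn U ψ g :=
  inner_smul_right _ _ _

theorem conj_twist (ξ : G →ₜ* Circle) (U : UnitaryRep G H) (g : G) (X : H →L[ℂ] H) :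
    (U.twist ξ).conj g X = U.conj g X := by
  rw [conj_apply, conj_apply, coe_twist_apply, map_smulₛₗ, comp_smul, comp_smul, smul_comp,
    smul_smul, Complex.conj_mul', Circle.norm_coe]
  simp

/-- The cyclic subspace generated by `ψ`, the smallest `U`-invariant subspace containing `ψ`. The
characteristic function of `ψ` determines it, with its representation and `ψ`, up to isometry. -/
abbrev cyclicSubspace (U : UnitaryRep G H) (ψ : H) : Submodule ℂ H :=
  Submodule.span ℂ (Set.range fun g => (U g : H →L[ℂ] H) ψ)

theorem self_mem_cyclicSubspace (U : UnitaryRep G H) (ψ : H) : ψ ∈ U.cyclicSubspace ψ :=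
  Submodule.subset_span ⟨1, U.map_one_apply ψ⟩

theorem cyclicSubspace_mem_invtSubmodule (U : UnitaryRep G H) (ψ : H) (g : G) :
    U.cyclicSubspace ψ ∈ Module.End.invtSubmodule (U g : H →L[ℂ] H).toLinearMap := by
  rw [Module.End.mem_invtSubmodule, cyclicSubspace, Submodule.span_le]
  rintro _ ⟨h, rfl⟩
  exact Submodule.subset_span ⟨g * h, U.map_mul_apply g h ψ⟩

theorem commute_starProjection_cyclicSubspace (U : UnitaryRep G H) (ψ : H) (g : G)
    [(U.cyclicSubspace ψ).HasOrthogonalProjection] :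
    Commute (U.cyclicSubspace ψ).starProjection (U g : H →L[ℂ] H) := by
  rw [IsIdempotentElem.commute_iff (Submodule.isIdempotentElem_starProjection _),
    Submodule.range_starProjection, Submodule.ker_starProjection]
  refine ⟨U.cyclicSubspace_mem_invtSubmodule ψ g, orthogonal_mem_invtSubmodule ?_⟩
  rw [adjoint_eq_map_inv]
  exact U.cyclicSubspace_mem_invtSubmodule ψ g⁻¹

end UnitaryRep

end Representation

section Intertwiner

variable {G H K : Type*} [Group G] [TopologicalSpace G]
  [NormedAddCommGroup H] [InnerProductSpace ℂ H] [CompleteSpace H]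
  [NormedAddCommGroup K] [InnerProductSpace ℂ K] [CompleteSpace K]

theorem exists_partialIsometry_intertwining {U : UnitaryRep G H} {V : UnitaryRep G K} {ψ : H}
    {φ : K} (h : ∀ g, charFn U ψ g = charFn V φ g)
    [(U.cyclicSubspace ψ).HasOrthogonalProjection] :
    ∃ W : H →L[ℂ] K, W ψ = φ ∧ adjoint W ∘L W = (U.cyclicSubspace ψ).starProjection ∧
      ∀ g, W ∘L (U g : H →L[ℂ] H) = (V g : K →L[ℂ] K) ∘L W := by
  have hinner (g k : G) : inner ℂ ((U g : H →L[ℂ] H) ψ) ((U k : H →L[ℂ] H) ψ) =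
      inner ℂ ((V g : K →L[ℂ] K) φ) ((V k : K →L[ℂ] K) φ) := by
    rw [U.inner_map_apply_map_apply, V.inner_map_apply_map_apply, h]
  obtain ⟨W, hWU, hWW, hWP⟩ := exists_partialIsometry_of_inner_eq hinner
  refine ⟨W, by simpa only [UnitaryRep.map_one_apply] using hWU 1, hWW, fun g => ?_⟩
  have horbit : Set.EqOn (W ∘L (U g : H →L[ℂ] H)) ((V g : K →L[ℂ] K) ∘L W)
      (Set.range fun k => (U k : H →L[ℂ] H) ψ) := by
    rintro _ ⟨k, rfl⟩
    simp only [comp_apply, hWU, ← UnitaryRep.map_mul_apply]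
  have hspan (x : H) (hx : x ∈ U.cyclicSubspace ψ) :
      W ((U g : H →L[ℂ] H) x) = (V g : K →L[ℂ] K) (W x) :=
    LinearMap.eqOn_span (f := (W ∘L (U g : H →L[ℂ] H)).toLinearMap)
      (g := ((V g : K →L[ℂ] K) ∘L W).toLinearMap) horbit hx
  ext x
  calc W ((U g : H →L[ℂ] H) x)
      = W ((U.cyclicSubspace ψ).starProjection ((U g : H →L[ℂ] H) x)) :=
        congr($hWP.symm ((U g : H →L[ℂ] H) x))
    _ = W ((U g : H →L[ℂ] H) ((U.cyclicSubspace ψ).starProjection x)) :=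
        congr(W ($((U.commute_starProjection_cyclicSubspace ψ g).eq) x))
    _ = (V g : K →L[ℂ] K) (W ((U.cyclicSubspace ψ).starProjection x)) :=
        hspan _ (Submodule.starProjection_apply_mem _ x)
    _ = (V g : K →L[ℂ] K) (W x) := congr((V g : K →L[ℂ] K) ($hWP x))

variable [FiniteDimensional ℂ H] [FiniteDimensional ℂ K]

theorem trace_comp_conj {U : UnitaryRep G H} {g : G} {Q : H →L[ℂ] H}
    (hQ : adjoint (U g : H →L[ℂ] H) ∘L Q ∘L (U g : H →L[ℂ] H) = Q) (X : H →L[ℂ] H) :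
    LinearMap.trace ℂ H (Q ∘L U.conj g X : H →L[ℂ] H) =
      LinearMap.trace ℂ H (Q ∘L X : H →L[ℂ] H) := by
  conv_rhs => rw [← hQ]
  rw [U.conj_apply, ← comp_assoc, ← comp_assoc, toLinearMap_comp, LinearMap.trace_comp_comm',
    ← toLinearMap_comp]
  simp only [comp_assoc]

theorem CovConvertible.of_intertwining_contraction [Nontrivial K] {U : UnitaryRep G H}
    {V : UnitaryRep G K} {W : H →L[ℂ] K} (hW : adjoint W ∘L W ≤ 1)
    (hUV : ∀ g, W ∘L (U g : H →L[ℂ] H) = (V g : K →L[ℂ] K) ∘L W) {ψ : H}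
    (hψ : adjoint W (W ψ) = ψ) : CovConvertible U V (pureState ψ) (pureState (W ψ)) := by
  obtain ⟨E, hE⟩ := exists_quantumOperation_of_contraction hW
  have hUV' (g : G) : adjoint (U g : H →L[ℂ] H) ∘L adjoint W =
      adjoint W ∘L adjoint (V g : K →L[ℂ] K) := by
    rw [← adjoint_comp, hUV, adjoint_comp]
  have hconj (g : G) (X : H →L[ℂ] H) :
      W ∘L U.conj g X ∘L adjoint W = V.conj g (W ∘L X ∘L adjoint W) := by
    rw [U.conj_apply, V.conj_apply, comp_assoc, comp_assoc, hUV', ← comp_assoc, hUV]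
    simp only [comp_assoc]
  have hWW (g : G) : adjoint (U g : H →L[ℂ] H) ∘L (adjoint W ∘L W) ∘L (U g : H →L[ℂ] H) =
      adjoint W ∘L W :=
    calc _ = (adjoint (U g : H →L[ℂ] H) ∘L adjoint W) ∘L (W ∘L (U g : H →L[ℂ] H)) := rfl
      _ = adjoint W ∘L (adjoint (V g : K →L[ℂ] K) ∘L (V g : K →L[ℂ] K)) ∘L W := by
        rw [hUV', hUV]; rfl
      _ = adjoint W ∘L W := by rw [V.adjoint_comp_self, one_def, id_comp]
  have hinv (g : G) : adjoint (U g : H →L[ℂ] H) ∘L (1 - adjoint W ∘L W) ∘L (U g : H →L[ℂ] H) =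
      1 - adjoint W ∘L W := by
    rw [sub_comp, comp_sub, hWW, one_def, id_comp, U.adjoint_comp_self, one_def]
  refine ⟨E, fun g X => ?_, ?_⟩
  · have hone : (V g : K →L[ℂ] K) ∘L 1 ∘L adjoint (V g : K →L[ℂ] K) = 1 := V.comp_adjoint_self g
    rw [hE, hE, hconj, trace_comp_conj (hinv g), V.conj_apply, V.conj_apply, add_comp, comp_add,
      smul_comp, comp_smul, hone]
  · have hψ' : (1 - adjoint W ∘L W) ψ = 0 := by
      rw [sub_apply, comp_apply, hψ]
      exact sub_self ψ
    rw [hE, pureState, comp_rankOne, hψ', rankOne_comp, adjoint_adjoint, comp_rankOne, pureState]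
    simp

theorem CovConvertible.of_charFn_eq {U : UnitaryRep G H} {V : UnitaryRep G K} {ψ : H} {φ : K}
    (hφ : φ ≠ 0) (h : ∀ g, charFn U ψ g = charFn V φ g) :
    CovConvertible U V (pureState ψ) (pureState φ) := by
  have : Nontrivial K := ⟨φ, 0, hφ⟩
  obtain ⟨W, rfl, hWW, hUV⟩ := exists_partialIsometry_intertwining h
  refine .of_intertwining_contraction ?_ hUV ?_
  · rw [hWW]
    exact isStarProjection_starProjection.le_one
  · rw [← comp_apply, hWW, Submodule.starProjection_eq_self_iff]
    exact U.self_mem_cyclicSubspace ψ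

theorem gEquivalent_twist_iff (ξ : G →ₜ* Circle) {U : UnitaryRep G H} {V : UnitaryRep G K}
    {ρ : H →L[ℂ] H} {σ : K →L[ℂ] K} : GEquivalent U (V.twist ξ) ρ σ ↔ GEquivalent U V ρ σ := by
  simp only [GEquivalent, CovConvertible, QuantumOperation.IsCovariant, UnitaryRep.conj_twist]

end Intertwiner

section Phase

variable {G H K : Type*} [Group G] [TopologicalSpace G]
  [NormedAddCommGroup H] [InnerProductSpace ℂ H] [CompleteSpace H] [FiniteDimensional ℂ H]
  [NormedAddCommGroup K] [InnerProductSpace ℂ K] [CompleteSpace K] [FiniteDimensional ℂ K]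
  {U : UnitaryRep G H} {V : UnitaryRep G K} {ψ : H} {φ : K}

open scoped ComplexOrder in
theorem QuantumOperation.exists_posSemidef_inner_eq (E : QuantumOperation H K) {n : Type*}
    [Finite n] {v : n → H} {w : n → K}
    (h : ∀ i, E.toLinearMap (pureState (v i)) = pureState (w i)) :
    ∃ A : Matrix n n ℂ, A.PosSemidef ∧
      ∀ i j, inner ℂ (v i) (v j) = A i j * inner ℂ (w i) (w j) := by
  obtain ⟨A, hA, hE⟩ := exists_posSemidef_map_rankOne E.toCompletelyPositiveMap h
  refine ⟨A.transpose, hA.transpose, fun i j => ?_⟩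
  rw [← trace_rankOne, ← trace_rankOne, ← E.trace_preserving, Matrix.transpose_apply, ← smul_eq_mul,
    ← map_smul, ← toLinearMap_smul]
  exact congrArg (fun T : K →L[ℂ] K => LinearMap.trace ℂ K T) (hE j i)

theorem CovConvertible.inner_self_eq (h : CovConvertible U V (pureState ψ) (pureState φ)) :
    inner ℂ ψ ψ = inner ℂ φ φ := by
  obtain ⟨E, -, hE⟩ := h
  rw [← trace_rankOne, ← trace_rankOne, ← pureState, ← pureState, ← hE, E.trace_preserving]

/- A covariant operation taking `ψ` to `φ` takes `U g ψ` to `V g φ` for all `g`. -/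
open scoped ComplexOrder in
theorem CovConvertible.exists_posSemidef (h : CovConvertible U V (pureState ψ) (pureState φ))
    (hφ : φ ≠ 0) {n : Type*} [Finite n] (s : n → G) :
    ∃ A : Matrix n n ℂ, A.PosSemidef ∧ (∀ i, A i i = 1) ∧
      ∀ i j, charFn U ψ ((s i)⁻¹ * s j) = A i j * charFn V φ ((s i)⁻¹ * s j) := by
  have hself := h.inner_self_eq
  obtain ⟨E, hcov, hE⟩ := h
  obtain ⟨A, hA, hAinner⟩ := E.exists_posSemidef_inner_eq (v := fun i => (U (s i) : H →L[ℂ] H) ψ)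
    (w := fun i => (V (s i) : K →L[ℂ] K) φ)
    fun i => by rw [← U.conj_pureState, hcov, hE, V.conj_pureState]
  simp only [UnitaryRep.inner_map_apply_map_apply] at hAinner
  refine ⟨A, hA, fun i => ?_, hAinner⟩
  have hii := hAinner i i
  rw [inv_mul_cancel, U.charFn_one, V.charFn_one, hself] at hii
  exact (mul_eq_right₀ (inner_self_ne_zero.2 hφ)).1 hii.symm

theorem CovConvertible.norm_charFn_le (h : CovConvertible U V (pureState ψ) (pureState φ))
    (hφ : φ ≠ 0) (g : G) : ‖charFn U ψ g‖ ≤ ‖charFn V φ g‖ := by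
  obtain ⟨A, hA, hdiag, hχ⟩ := h.exists_posSemidef hφ ![1, g]
  have hg : charFn U ψ g = A 0 1 * charFn V φ g := by simpa using hχ 0 1
  rw [hg, norm_mul]
  exact mul_le_of_le_one_left (norm_nonneg _) (norm_apply_le_one_of_posSemidef hA hdiag 0 1)

theorem GEquivalent.norm_charFn_eq (h : GEquivalent U V (pureState ψ) (pureState φ))
    (hφ : φ ≠ 0) (g : G) : ‖charFn U ψ g‖ = ‖charFn V φ g‖ := by
  have hψ : ψ ≠ 0 := by
    rw [← inner_self_ne_zero (𝕜 := ℂ), h.1.inner_self_eq]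
    exact inner_self_ne_zero.2 hφ
  exact (h.1.norm_charFn_le hφ g).antisymm (h.2.norm_charFn_le hψ g)

theorem GEquivalent.charFn_div_mul (h : GEquivalent U V (pureState ψ) (pureState φ))
    (hχ : ∀ g, charFn V φ g ≠ 0) (g k : G) :
    charFn U ψ (g * k) / charFn V φ (g * k) =
      charFn U ψ g / charFn V φ g * (charFn U ψ k / charFn V φ k) := by
  have hφ : φ ≠ 0 := V.ne_zero_of_charFn_ne_zero (hχ 1)
  obtain ⟨A, hA, hdiag, hAχ⟩ := h.1.exists_posSemidef hφ ![1, g, g * k]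
  have h₀₁ : charFn U ψ g = A 0 1 * charFn V φ g := by simpa using hAχ 0 1
  have h₀₂ : charFn U ψ (g * k) = A 0 2 * charFn V φ (g * k) := by simpa using hAχ 0 2
  have h₁₂ : charFn U ψ k = A 1 2 * charFn V φ k := by simpa using hAχ 1 2
  have hnorm : ‖A 1 2‖ = 1 := by
    rw [eq_div_of_mul_eq (hχ k) h₁₂.symm, norm_div, h.norm_charFn_eq hφ,
      div_self (norm_ne_zero_iff.2 (hχ k))]
  rw [h₀₁, h₀₂, h₁₂, mul_div_cancel_right₀ _ (hχ _), mul_div_cancel_right₀ _ (hχ _),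
    mul_div_cancel_right₀ _ (hχ _)]
  exact apply_eq_mul_of_posSemidef hA hdiag hnorm 0

theorem GEquivalent.exists_phase (h : GEquivalent U V (pureState ψ) (pureState φ))
    (hχ : ∀ g, charFn V φ g ≠ 0) :
    ∃ ξ : G →ₜ* Circle, ∀ g, charFn U ψ g = ξ g * charFn V φ g := by
  have hφ : φ ≠ 0 := V.ne_zero_of_charFn_ne_zero (hχ 1)
  have hnorm (g : G) : ‖charFn U ψ g / charFn V φ g‖ = 1 := by
    rw [norm_div, h.norm_charFn_eq hφ, div_self (norm_ne_zero_iff.2 (hχ g))]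
  let ξ : G →* Circle :=
    MonoidHom.mk' (fun g => ⟨charFn U ψ g / charFn V φ g, mem_sphere_zero_iff_norm.2 (hnorm g)⟩)
      fun g k => Circle.ext (h.charFn_div_mul hχ g k)
  have hξ : Continuous ξ :=
    ((U.continuous_charFn ψ).div (V.continuous_charFn φ) hχ).subtype_mk _
  exact ⟨⟨ξ, hξ⟩, fun g => (div_mul_cancel₀ _ (hχ g)).symm⟩

end Phase

theorem mainTheorem3_general {G H K : Type*} [Group G] [TopologicalSpace G]
    [NormedAddCommGroup H] [InnerProductSpace ℂ H] [CompleteSpace H] [FiniteDimensional ℂ H]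
    [NormedAddCommGroup K] [InnerProductSpace ℂ K] [CompleteSpace K] [FiniteDimensional ℂ K]
    (U : UnitaryRep G H) (V : UnitaryRep G K) (ψ : H) (φ : K) (hχ : ∀ g : G, charFn V φ g ≠ 0) :
    GEquivalent U V (pureState ψ) (pureState φ) ↔
      ∃ ξ : G →ₜ* Circle, ∀ g : G, charFn U ψ g = (ξ g : ℂ) * charFn V φ g := by
  refine ⟨fun h => h.exists_phase hχ, fun ⟨ξ, hξ⟩ => ?_⟩
  have htwist (g : G) : charFn U ψ g = charFn (V.twist ξ) φ g := by rw [hξ, V.charFn_twist]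
  have hφ : φ ≠ 0 := V.ne_zero_of_charFn_ne_zero (hχ 1)
  have hψ : ψ ≠ 0 := U.ne_zero_of_charFn_ne_zero (g := 1) <| by
    rw [hξ]
    exact mul_ne_zero (Circle.coe_ne_zero _) (hχ 1)
  rw [← gEquivalent_twist_iff ξ]
  exact ⟨.of_charFn_eq hφ htwist, .of_charFn_eq hψ fun g => (htwist g).symm⟩

theorem mainTheorem3 {G H K : Type*} [Group G] [TopologicalSpace G]
    (hG : IsFiniteOrCompactLieGroup G)
    [NormedAddCommGroup H] [InnerProductSpace ℂ H] [CompleteSpace H] [FiniteDimensional ℂ H]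
    [NormedAddCommGroup K] [InnerProductSpace ℂ K] [CompleteSpace K] [FiniteDimensional ℂ K]
    (U : UnitaryRep G H) (V : UnitaryRep G K)
    (ψ : H) (φ : K) (hψ : ‖ψ‖ = 1) (hφ : ‖φ‖ = 1)
    (hχψ : ∀ g : G, charFn U ψ g ≠ 0) (hχφ : ∀ g : G, charFn V φ g ≠ 0) :
    GEquivalent U V (pureState ψ) (pureState φ) ↔
      ∃ ξ : G →ₜ* Circle, ∀ g : G, charFn U ψ g = (ξ g : ℂ) * charFn V φ g :=
  mainTheorem3_general U V ψ φ hχφ
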